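/- Let $\mathfrak g$ be a finite-dimensional real semisimple Lie algebra with Killing form $B$, let $\theta$ be a Cartan involution of $\mathfrak g$ with Cartan decomposition $\mathfrak g=\mathfrak k\oplus\mathfrak p$ ($\mathfrak k$ and $\mathfrak p$ being the $+1$- and $-1$-eigenspaces of $\theta$), and assume that $\mathfrak k$ contains no nonzero ideal of $\mathfrak g$. Equip $\mathfrak g$ with the inner product $B_\theta(X,Y)=-B(X,\theta Y)$; for subspaces $U\subseteq V$ of $\mathfrak g$ let $V\ominus U$ be the $B_\theta$-orthogonal complement of $U$ in $V$, and let $Z_V(S)$ be the set of elements of $V$ commuting with every element of $S$. Let $\mathfrak a$ be a maximal abelian subspace of $\mathfrak p$. For $\alpha\in\mathfrak a^*$ put $\mathfrak g_\alpha=\{X\in\mathfrak g : [H,X]=\alpha(H)X \text{ for all } H\in\mathfrak a\}$, let $\Sigma=\{\alpha\ne0:\mathfrak g_\alpha\ne0\}$ be the set of restricted roots, let $\alpha_1,\dots,\alpha_r$ be a system of simple roots of $\Sigma$, and let $\mathfrak k_0=Z_{\mathfrak k}(\mathfrak a)$. Fix $j\in\{1,\dots,r\}$ and put $\Phi_j=\{\alpha_i: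 i\neq j\}$, $\Sigma_j=\Sigma\cap\operatorname{span}_{\mathbb R}\Phi_j$, and $$\mathfrak l_j=\mathfrak g_0\oplus\bigoplus_{\alpha\in\Sigma_j}\mathfrak g_\alpha,\qquad \mathfrak a_j=\bigcap_{\alpha\in\Phi_j}\ker\alpha\subseteq\mathfrak a,\qquad \mathfrak m_j=\mathfrak l_j\ominus\mathfrak a_j .$$ Here $\mathfrak m_j$ is a Lie subalgebra of $\mathfrak g$. Let $\mathfrak z_j$ be the center of $\mathfrak m_j$, let $\mathfrak g_j=[\mathfrak m_j,\mathfrak m_j]$ and $\mathfrak b_j=\mathfrak g_j\cap\mathfrak p$. The compact (respectively noncompact) part of a semisimple real Lie algebra is the sum of all its simple ideals whose Killing form is (respectively is not) negative definite. Then $\mathfrak g_j$ is semisimple, and: 1. the noncompact part of $\mathfrak g_j$ is the Lie subalgebra of $\mathfrak g$ generated by the root spaces $\mathfrak g_\alpha$ with $\alpha\in\Sigma_j$; 2. $\mathfrak z_j\subseteq Z_{\mathfrak k_0}(\mathfrak b_j)$, and the compact part of $\mathfrak g_j$ is $Z_{\mathfrak k_0}(\mathfrak b_j)\ominus\mathfrak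 z_j$; 3. the compact and noncompact parts of $\mathfrak g_j$ are orthogonal with respect to $B_\theta$. -/

import Mathlib

namespace NoncompactPart

noncomputable section

open Module

/-! ### Compact and noncompact parts of a semisimple real Lie algebra -/

section Parts

variable (h : Type*) [LieRing h] [LieAlgebra ℝ h]

/-- A (semisimple) real Lie algebra is compact if its Killing form is negative definite. -/
def IsCompactAlgebra : Prop :=
  ∀ x : h, x ≠ 0 → killingForm ℝ h x x < 0

/-- The compact part: the sum of all simple ideals that are compact. -/
def compactPart : LieIdeal ℝ h :=
  sSup {I : LieIdeal ℝ h | LieAlgebra.IsSimple ℝ I ∧ IsCompactAlgebra I}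

/-- The noncompact part: the sum of all simple ideals that are not compact. -/
def noncompactPart : LieIdeal ℝ h :=
  sSup {I : LieIdeal ℝ h | LieAlgebra.IsSimple ℝ I ∧ ¬ IsCompactAlgebra I}

end Parts

variable {g : Type*} [LieRing g] [LieAlgebra ℝ g]

/-! ### Cartan involutions -/

/-- The form `B_θ(x, y) = -B(x, θ y)`, where `B` is the Killing form. -/
def formTheta (θ : g ≃ₗ⁅ℝ⁆ g) (x y : g) : ℝ :=
  -killingForm ℝ g x (θ y)

/-- A Cartan involution: an involutive automorphism with `B_θ` positive definite. -/
structure IsCartanInvolution (θ : g ≃ₗ⁅ℝ⁆ g) : Prop where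
  involutive : ∀ x, θ (θ x) = x
  pos_def : ∀ x, x ≠ 0 → 0 < formTheta θ x x

/-- `𝔨`, the `+1`-eigenspace of `θ`. -/
def kPart (θ : g ≃ₗ⁅ℝ⁆ g) : Submodule ℝ g where
  carrier := {x | θ x = x}
  add_mem' {x y} hx hy := by
    simp only [Set.mem_ofPred_eq] at *
    rw [map_add, hx, hy]
  zero_mem' := by simp
  smul_mem' c x hx := by
    simp only [Set.mem_ofPred_eq] at *
    rw [map_smul, hx]

/-- `𝔭`, the `-1`-eigenspace of `θ`. -/
def pPart (θ : g ≃ₗ⁅ℝ⁆ g) : Submodule ℝ g where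
  carrier := {x | θ x = -x}
  add_mem' {x y} hx hy := by
    simp only [Set.mem_ofPred_eq] at *
    rw [map_add, hx, hy, neg_add]
  zero_mem' := by simp
  smul_mem' c x hx := by
    simp only [Set.mem_ofPred_eq] at *
    rw [map_smul, hx, smul_neg]

/-- `V ⊖ U`: the vectors of `V` that are `B_θ`-orthogonal to `U`. -/
def orthIn (θ : g ≃ₗ⁅ℝ⁆ g) (V U : Submodule ℝ g) : Submodule ℝ g where
  carrier := {x | x ∈ V ∧ ∀ u ∈ U, formTheta θ x u = 0}
  add_mem' {x y} hx hy := by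
    refine ⟨V.add_mem hx.1 hy.1, fun u hu => ?_⟩
    have h1 := hx.2 u hu
    have h2 := hy.2 u hu
    simp only [formTheta, neg_eq_zero] at h1 h2 ⊢
    rw [map_add, LinearMap.add_apply, h1, h2, add_zero]
  zero_mem' := ⟨V.zero_mem, fun u _ => by simp [formTheta]⟩
  smul_mem' c x hx := by
    refine ⟨V.smul_mem c hx.1, fun u hu => ?_⟩
    have h1 := hx.2 u hu
    simp only [formTheta, neg_eq_zero] at h1 ⊢
    rw [map_smul, LinearMap.smul_apply, h1, smul_zero]

/-- `Z_V(S)`: the elements of `V` that commute with every element of `S`. -/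
def centralizerIn (V S : Submodule ℝ g) : Submodule ℝ g where
  carrier := {x | x ∈ V ∧ ∀ s ∈ S, ⁅x, s⁆ = 0}
  add_mem' {x y} hx hy :=
    ⟨V.add_mem hx.1 hy.1, fun s hs => by rw [add_lie, hx.2 s hs, hy.2 s hs, add_zero]⟩
  zero_mem' := ⟨V.zero_mem, fun s _ => zero_lie s⟩
  smul_mem' c x hx :=
    ⟨V.smul_mem c hx.1, fun s hs => by rw [smul_lie, hx.2 s hs, smul_zero]⟩

/-- `𝔞` is a maximal abelian subspace of `𝔭`. -/
def IsMaximalAbelian (θ : g ≃ₗ⁅ℝ⁆ g) (a : Submodule ℝ g) : Prop :=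
  Maximal (fun s : Submodule ℝ g => s ≤ pPart θ ∧ ∀ x ∈ s, ∀ y ∈ s, ⁅x, y⁆ = 0) a

/-! ### Restricted roots -/

/-- `𝔤_α = {x | [H, x] = α(H) x for all H ∈ 𝔞}`; in particular `𝔤_0 = Z_𝔤(𝔞)`. -/
def rootSpace (a : Submodule ℝ g) (α : Dual ℝ a) : Submodule ℝ g where
  carrier := {x | ∀ H : a, ⁅(H : g), x⁆ = α H • x}
  add_mem' {x y} hx hy := fun H => by rw [lie_add, hx H, hy H, smul_add]
  zero_mem' := fun H => by rw [lie_zero, smul_zero]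
  smul_mem' c x hx := fun H => by rw [lie_smul, hx H, smul_comm]

/-- `Σ`, the set of restricted roots of `𝔤` with respect to `𝔞`. -/
def roots (a : Submodule ℝ g) : Set (Dual ℝ a) :=
  {α | α ≠ 0 ∧ rootSpace a α ≠ ⊥}

/-- `α₁, …, α_r` is a system of simple roots of `Σ`: a basis of `𝔞*` consisting of roots such that
every root is a combination of the `αᵢ` with nonnegative integer coefficients, or the negative
of such a combination. -/
def IsSimpleSystem {a : Submodule ℝ g} {r : ℕ} (α : Basis (Fin r) ℝ (Dual ℝ a)) : Prop :=
  (∀ i, α i ∈ roots a) ∧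
    ∀ β ∈ roots a, ∃ c : Fin r → ℕ, β = ∑ i, c i • α i ∨ β = -∑ i, c i • α i

lemma lie_mem_rootSpace {a : Submodule ℝ g} {α β : Dual ℝ a} {x y : g}
    (hx : x ∈ rootSpace a α) (hy : y ∈ rootSpace a β) : ⁅x, y⁆ ∈ rootSpace a (α + β) := by
  intro H
  rw [leibniz_lie, hx H, hy H, smul_lie, lie_smul, LinearMap.add_apply, add_smul]

/-! ### The subalgebras attached to a simple root -/

variable (g) in
/-- The data fixed throughout: a Cartan involution `θ` of `𝔤` such that `𝔨` contains no nonzero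
ideal of `𝔤`, a maximal abelian subspace `𝔞` of `𝔭`, and simple roots `α₁, …, α_r`. -/
structure Data where
  θ : g ≃ₗ⁅ℝ⁆ g
  cartan : IsCartanInvolution θ
  no_ideal : ∀ I : LieIdeal ℝ g, (∀ x ∈ I, x ∈ kPart θ) → I = ⊥
  a : Submodule ℝ g
  maximal_a : IsMaximalAbelian θ a
  r : ℕ
  simple : Basis (Fin r) ℝ (Dual ℝ a)
  isSimpleSystem : IsSimpleSystem simple

namespace Data

variable (D : Data g) (j : Fin D.r)

/-- `Φ_j = {α₁, …, α_r} \ {α_j}`. -/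
def Phi : Set (Dual ℝ D.a) := {β | ∃ i, i ≠ j ∧ β = D.simple i}

/-- `Σ_j`, the root subsystem generated by `Φ_j`: the roots in the linear span of `Φ_j`. -/
def rootsJ : Set (Dual ℝ D.a) := {β | β ∈ roots D.a ∧ β ∈ Submodule.span ℝ (D.Phi j)}

/-- `𝔨₀ = Z_𝔨(𝔞)`. -/
def k0 : Submodule ℝ g := centralizerIn (kPart D.θ) D.a

/-- `𝔞_j`, the intersection of the kernels of the roots in `Φ_j`. -/
def aJ : Submodule ℝ g where
  carrier := {x | ∃ hx : x ∈ D.a, ∀ β ∈ D.Phi j, β ⟨x, hx⟩ = 0}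
  add_mem' := by
    rintro x y ⟨hx, hx'⟩ ⟨hy, hy'⟩
    refine ⟨D.a.add_mem hx hy, fun β hβ => ?_⟩
    have h := map_add β ⟨x, hx⟩ ⟨y, hy⟩
    rw [hx' β hβ, hy' β hβ, add_zero] at h
    exact h
  zero_mem' := ⟨D.a.zero_mem, fun β _ => map_zero β⟩
  smul_mem' := by
    rintro c x ⟨hx, hx'⟩
    refine ⟨D.a.smul_mem c hx, fun β hβ => ?_⟩
    have h := map_smul β c ⟨x, hx⟩
    rw [hx' β hβ, smul_zero] at h
    exact h

/-- `𝔩_j = 𝔤_0 ⊕ ⨁_{α ∈ Σ_j} 𝔤_α`. -/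
def lJ : Submodule ℝ g :=
  rootSpace D.a 0 ⊔ ⨆ β ∈ D.rootsJ j, rootSpace D.a β

/-- `𝔪_j = 𝔩_j ⊖ 𝔞_j`, as a subspace. -/
def mJSubmodule : Submodule ℝ g := orthIn D.θ (D.lJ j) (D.aJ j)

lemma rootSpace_le_lJ {β : Dual ℝ D.a} (hβ : β ∈ Submodule.span ℝ (D.Phi j)) :
    rootSpace D.a β ≤ D.lJ j := by
  by_cases h0 : β = 0
  · subst h0
    exact le_sup_left
  by_cases h1 : rootSpace D.a β = ⊥
  · rw [h1]
    exact bot_le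
  · exact le_sup_of_le_right (le_iSup₂_of_le β ⟨⟨h0, h1⟩, hβ⟩ le_rfl)

lemma lJ_le {p : Submodule ℝ g}
    (h : ∀ β ∈ Submodule.span ℝ (D.Phi j), rootSpace D.a β ≤ p) : D.lJ j ≤ p :=
  sup_le (h 0 (Submodule.zero_mem _)) (iSup₂_le fun β hβ => h β hβ.2)

lemma lie_mem_lJ {x y : g} (hx : x ∈ D.lJ j) (hy : y ∈ D.lJ j) : ⁅x, y⁆ ∈ D.lJ j := by
  have h1 : D.lJ j ≤ (D.lJ j).comap (LieAlgebra.ad ℝ g x : g →ₗ[ℝ] g) := by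
    refine D.lJ_le j fun β hβ z hz => ?_
    have h2 : D.lJ j ≤ (D.lJ j).comap (LieAlgebra.ad ℝ g z : g →ₗ[ℝ] g) :=
      D.lJ_le j fun γ hγ w hw =>
        D.rootSpace_le_lJ j (Submodule.add_mem _ hβ hγ) (lie_mem_rootSpace hz hw)
    have h3 : ⁅z, x⁆ ∈ D.lJ j := h2 hx
    change ⁅x, z⁆ ∈ D.lJ j
    rw [← lie_skew]
    exact (D.lJ j).neg_mem h3
  exact h1 hy

lemma lie_aJ_lJ {x h : g} (hx : x ∈ D.lJ j) (hh : h ∈ D.aJ j) : ⁅h, x⁆ = 0 := by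
  obtain ⟨ha, hh⟩ := hh
  have h1 : D.lJ j ≤ LinearMap.ker (LieAlgebra.ad ℝ g h : g →ₗ[ℝ] g) := by
    refine D.lJ_le j fun β hβ z hz => ?_
    have h2 : Submodule.span ℝ (D.Phi j) ≤
        LinearMap.ker (Dual.eval ℝ D.a (⟨h, ha⟩ : D.a)) :=
      Submodule.span_le.2 fun γ hγ => hh γ hγ
    have h2 : β ⟨h, ha⟩ = 0 := h2 hβ
    have h3 : ⁅h, z⁆ = β ⟨h, ha⟩ • z := hz ⟨h, ha⟩
    rw [LinearMap.mem_ker, LieAlgebra.ad_apply, h3, h2, zero_smul]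
  exact h1 hx

lemma lie_mem_mJSubmodule {x y : g} (hx : x ∈ D.mJSubmodule j) (hy : y ∈ D.mJSubmodule j) :
    ⁅x, y⁆ ∈ D.mJSubmodule j := by
  refine ⟨D.lie_mem_lJ j hx.1 hy.1, fun u hu => ?_⟩
  have h1 : D.θ u = -u := D.maximal_a.prop.1 hu.1
  have h2 : ⁅y, u⁆ = 0 := by rw [← lie_skew, D.lie_aJ_lJ j hy.1 hu, neg_zero]
  rw [formTheta, h1, map_neg, LieModule.traceForm_apply_lie_apply, h2]
  simp

/-- `𝔪_j = 𝔩_j ⊖ 𝔞_j`. -/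
def mJ : LieSubalgebra ℝ g :=
  { D.mJSubmodule j with lie_mem' := fun hx hy => D.lie_mem_mJSubmodule j hx hy }

/-- `𝔷_j`, the center of `𝔪_j`. -/
def zJ : Submodule ℝ g := centralizerIn (D.mJ j).toSubmodule (D.mJ j).toSubmodule

/-- `𝔤_j = [𝔪_j, 𝔪_j]`, the linear span of all brackets. -/
def gJ : LieSubalgebra ℝ g :=
  { Submodule.span ℝ {z : g | ∃ x ∈ D.mJ j, ∃ y ∈ D.mJ j, ⁅x, y⁆ = z} with
    lie_mem' := fun {u v} hu hv => by
      have hle : Submodule.span ℝ {z : g | ∃ x ∈ D.mJ j, ∃ y ∈ D.mJ j, ⁅x, y⁆ = z} ≤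
          (D.mJ j).toSubmodule := by
        rw [Submodule.span_le]
        rintro _ ⟨x, hx, y, hy, rfl⟩
        exact (D.mJ j).lie_mem hx hy
      exact Submodule.subset_span ⟨u, hle hu, v, hle hv, rfl⟩ }

/-- `𝔟_j = 𝔤_j ∩ 𝔭`. -/
def bJ : Submodule ℝ g := (D.gJ j).toSubmodule ⊓ pPart D.θ

/-- The Lie subalgebra of `𝔤` generated by the root spaces `𝔤_α`, `α ∈ Σ_j`. -/
def gTilde : LieSubalgebra ℝ g :=
  LieSubalgebra.lieSpan ℝ g (⋃ β ∈ D.rootsJ j, (rootSpace D.a β : Set g))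

/-- The noncompact part of `𝔤_j`, viewed as a subspace of `𝔤`. -/
def noncompactPartJ : Submodule ℝ g :=
  (noncompactPart (D.gJ j)).toSubmodule.map (D.gJ j).toSubmodule.subtype

/-- The compact part of `𝔤_j`, viewed as a subspace of `𝔤`. -/
def compactPartJ : Submodule ℝ g :=
  (compactPart (D.gJ j)).toSubmodule.map (D.gJ j).toSubmodule.subtype

end Data

end

end NoncompactPart

namespace NoncompactPart

open Module

/-! ### Traces and positive definite forms -/

/-! A semisimple algebra with an involution `θ` and an invariant form `Φ` such that `-Φ(x, θ y)` is
positive definite has `θ`-stable simple ideals, and such an ideal is compact exactly when `θ` fixes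
it pointwise. So (`IsCartanPair.parts_eq`) an ideal `N` is the noncompact part, and its centralizer
the compact part, once `θ` fixes the centralizer and no simple ideal inside `N` is fixed.

The algebra `𝔤_j` inherits such a pair from `𝔤`, and `𝔪_j` splits orthogonally into `𝔷_j` and `𝔤_j`,
which gives semisimplicity. Take for `N` the algebra generated by the `𝔤_β`, `β ∈ Σ_j`. An element
of `𝔤_j` commuting with these is orthogonal to them, so lies in `𝔤_0`; its `𝔭`-component lies in `𝔞`
by maximality, is killed by `Φ_j`, and is orthogonal to `𝔞_j`, hence vanishes
(`theta_eq_self_of_commute`). A simple ideal in `N` fixed by `θ` would lie in `𝔤_0`, hence commute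
with every `𝔤_β` and so with itself (`not_fixed_of_le_gTildeIdeal`). The description of the compact
part follows by comparing `𝔨` with `𝔭` and `𝔤_β` with `𝔤_{-β}`. -/

lemma trace_comp_pos_of_adjoint {V : Type*} [AddCommGroup V] [Module ℝ V] [FiniteDimensional ℝ V]
    (Ψ : LinearMap.BilinForm ℝ V) (hsymm : ∀ x y, Ψ x y = Ψ y x) (hpos : ∀ x, x ≠ 0 → 0 < Ψ x x)
    {S T : V →ₗ[ℝ] V} (hST : ∀ x y, Ψ (T x) y = Ψ x (S y)) (hT : T ≠ 0) :
    0 < LinearMap.trace ℝ V (S ∘ₗ T) := by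
  obtain ⟨v, hv⟩ := LinearMap.BilinForm.exists_orthogonal_basis (B := Ψ) ⟨hsymm⟩
  have hvpos : ∀ i, 0 < Ψ (v i) (v i) := fun i => hpos _ (v.ne_zero i)
  have hcoord : ∀ x i, v.repr x i = Ψ (v i) x / Ψ (v i) (v i) := by
    intro x i
    rw [eq_div_iff (hvpos i).ne']
    conv_rhs => rw [← v.sum_repr x]
    rw [map_sum, Finset.sum_eq_single i]
    · simp
    · intro k _ hk
      have : Ψ (v i) (v k) = 0 := hv hk.symm
      simp [this]
    · simp
  -- In a `Ψ`-orthogonal basis, adjointness turns each diagonal entry into a normalized squared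
  -- length of `T (v i)`.
  have htr : LinearMap.trace ℝ V (S ∘ₗ T) =
      ∑ i, Ψ (T (v i)) (T (v i)) / Ψ (v i) (v i) := by
    rw [LinearMap.trace_eq_matrix_trace ℝ v, Matrix.trace]
    refine Finset.sum_congr rfl fun i _ => ?_
    rw [Matrix.diag_apply, LinearMap.toMatrix_apply, hcoord, LinearMap.comp_apply, hST]
  have hnonneg : ∀ x, 0 ≤ Ψ x x := by
    intro x
    by_cases hx : x = 0
    · simp [hx]
    · exact (hpos x hx).le
  rw [htr]
  obtain ⟨i, hi⟩ : ∃ i, T (v i) ≠ 0 := by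
    by_contra! h
    exact hT (v.ext fun i => by simp [h i])
  exact Finset.sum_pos' (fun k _ => div_nonneg (hnonneg _) (hnonneg _))
    ⟨i, Finset.mem_univ _, div_pos (hpos _ hi) (hvpos i)⟩

/-! ### Lie algebras with a Cartan pair -/

section CartanPair

variable {h : Type*} [LieRing h] [LieAlgebra ℝ h]

/-- An involution `θ` and an invariant symmetric form `Φ` such that `-Φ(x, θ y)` is positive
definite. -/
structure IsCartanPair (θ : h →ₗ⁅ℝ⁆ h) (Φ : LinearMap.BilinForm ℝ h) : Prop where
  involutive : ∀ x, θ (θ x) = x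
  symm : ∀ x y, Φ x y = Φ y x
  invariant : ∀ x y z, Φ ⁅x, y⁆ z = Φ x ⁅y, z⁆
  map_map : ∀ x y, Φ (θ x) (θ y) = Φ x y
  neg : ∀ x, x ≠ 0 → Φ x (θ x) < 0

namespace IsCartanPair

variable {θ : h →ₗ⁅ℝ⁆ h} {Φ : LinearMap.BilinForm ℝ h}

lemma eq_zero (H : IsCartanPair θ Φ) {x : h} (hx : Φ x (θ x) = 0) : x = 0 := by
  by_contra h0
  exact (H.neg x h0).ne hx

lemma map_right (H : IsCartanPair θ Φ) (x y : h) : Φ x (θ y) = Φ (θ x) y := by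
  rw [← H.map_map, H.involutive]

/-- Invariance turns the hypothesis into the vanishing of the squared length of `⁅x, z⁆`. This
promotes commuting with a smaller subspace to centrality. -/
lemma lie_eq_zero (H : IsCartanPair θ Φ) {x z : h} (h0 : ⁅x, θ ⁅x, z⁆⁆ = 0) : ⁅x, z⁆ = 0 := by
  refine H.eq_zero ?_
  rw [← lie_skew x z, map_neg, LinearMap.neg_apply, H.invariant, lie_skew x z, h0]
  simp

lemma nondegenerate (H : IsCartanPair θ Φ) : Φ.Nondegenerate := by
  refine ⟨fun x hx => H.eq_zero (hx _), fun x hx => H.eq_zero ?_⟩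
  rw [H.symm]
  exact hx _

lemma lieInvariant (H : IsCartanPair θ Φ) : Φ.lieInvariant h := by
  intro x y z
  rw [← H.invariant, ← lie_skew x y, map_neg, LinearMap.neg_apply]

/-- A subalgebra stable under `θ` inherits the Cartan pair. -/
lemma restrict (H : IsCartanPair θ Φ) (s : LieSubalgebra ℝ h) (θs : s →ₗ⁅ℝ⁆ s)
    (hθ : ∀ x, (θs x : h) = θ x) :
    IsCartanPair θs (Φ.restrict s.toSubmodule) where
  involutive x := Subtype.ext (by rw [hθ, hθ, H.involutive])
  symm x y := H.symm x y
  invariant x y z := H.invariant x y z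
  map_map x y := by
    change Φ (θs x : h) (θs y : h) = Φ (x : h) (y : h)
    rw [hθ, hθ, H.map_map]
  neg x hx := by
    change Φ (x : h) (θs x : h) < 0
    rw [hθ]
    exact H.neg x (by simpa using hx)

/-- The ideal `I ∩ θ⁻¹(I)` is either `I` or zero by minimality, and it contains `[I, θ I]`. -/
lemma atom_stable_or_lie_eq_zero {I : LieIdeal ℝ h} (H : IsCartanPair θ Φ) (hI : IsAtom I) :
    (∀ x ∈ I, θ x ∈ I) ∨ ∀ x ∈ I, ∀ y ∈ I, ⁅x, θ y⁆ = 0 := by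
  rcases hI.le_iff.1 (inf_le_left : I ⊓ I.comap θ ≤ I) with h0 | h1
  · right
    intro x hx y hy
    have : ⁅x, θ y⁆ ∈ I ⊓ I.comap θ := by
      refine ⟨lie_mem_left ℝ h I x _ hx, ?_⟩
      change θ ⁅x, θ y⁆ ∈ I
      rw [LieHom.map_lie, H.involutive]
      exact lie_mem_right ℝ h I _ y hy
    rwa [h0, LieSubmodule.mem_bot] at this
  · left
    intro x hx
    have : x ∈ I ⊓ I.comap θ := by rwa [h1]
    exact LieIdeal.mem_comap.1 this.2

/-- With a nondegenerate invariant form it suffices to exclude abelian minimal ideals. In either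
case of `atom_stable_or_lie_eq_zero`, an abelian one is central. -/
lemma isSemisimple [FiniteDimensional ℝ h] (H : IsCartanPair θ Φ)
    (hcenter : ∀ x : h, (∀ y : h, ⁅x, y⁆ = 0) → x = 0) : LieAlgebra.IsSemisimple ℝ h := by
  refine LieAlgebra.InvariantForm.isSemisimple_of_nondegenerate Φ H.nondegenerate H.lieInvariant
    (fun x y hxy => by rw [H.symm, hxy]) fun I hI hab => ?_
  refine hI.1 ((LieSubmodule.eq_bot_iff I).2 fun x hx => hcenter x fun z => H.lie_eq_zero ?_)
  have hw : ⁅x, z⁆ ∈ I := lie_mem_left ℝ h I x z hx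
  rcases H.atom_stable_or_lie_eq_zero hI with hs | h0
  · have := hab.trivial ⟨x, hx⟩ ⟨_, hs _ hw⟩
    simpa using congrArg (Subtype.val : I → h) this
  · exact h0 x hx _ hw

lemma atom_stable [LieAlgebra.IsSemisimple ℝ h] {I : LieIdeal ℝ h} (H : IsCartanPair θ Φ)
    (hI : IsAtom I) : ∀ x ∈ I, θ x ∈ I := by
  refine (H.atom_stable_or_lie_eq_zero hI).resolve_right fun h0 => ?_
  refine LieAlgebra.IsSemisimple.non_abelian_of_isAtom I hI ⟨fun x y => Subtype.ext ?_⟩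
  refine H.eq_zero ?_
  change Φ ⁅(x : h), (y : h)⁆ (θ (⁅x, y⁆ : I)) = 0
  rw [H.invariant, h0 _ y.2 _ (⁅x, y⁆ : I).2, map_zero]

lemma eq_zero_of_mem_atom [LieAlgebra.IsSemisimple ℝ h] {I : LieIdeal ℝ h} (hI : IsAtom I)
    {x : h} (hx : x ∈ I) (h0 : ∀ y ∈ I, ⁅x, y⁆ = 0) : x = 0 := by
  have := LieAlgebra.IsSemisimple.isSimple_of_isAtom I hI
  have hc : (⟨x, hx⟩ : I) ∈ LieAlgebra.center ℝ I := by
    intro y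
    rw [← lie_skew, neg_eq_zero]
    exact Subtype.ext (h0 y y.2)
  rw [LieAlgebra.center_eq_bot, LieSubmodule.mem_bot] at hc
  exact congrArg Subtype.val hc

lemma ad_ne_zero_of_mem_atom [LieAlgebra.IsSemisimple ℝ h] {I : LieIdeal ℝ h} (hI : IsAtom I)
    {x : I} (hx : x ≠ 0) : (LieAlgebra.ad ℝ I x : I →ₗ[ℝ] I) ≠ 0 := by
  intro h0
  refine hx (Subtype.ext (eq_zero_of_mem_atom hI x.2 fun y hy => ?_))
  exact congrArg Subtype.val (LinearMap.congr_fun h0 ⟨y, hy⟩)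

/-- The Killing form of an atom in terms of the adjoint with respect to `-Φ(x, θ y)`. -/
lemma killingForm_map_neg [FiniteDimensional ℝ h] [LieAlgebra.IsSemisimple ℝ h] {I : LieIdeal ℝ h}
    (H : IsCartanPair θ Φ) (hI : IsAtom I) {x y : I} (hx : x ≠ 0) (hxy : (y : h) = θ x) :
    killingForm ℝ I y x < 0 := by
  let Ψ : LinearMap.BilinForm ℝ I :=
    -LinearMap.BilinForm.restrict (Φ.compl₁₂ LinearMap.id (θ : h →ₗ[ℝ] h)) I.toSubmodule
  have hΨ : ∀ u v : I, Ψ u v = -Φ u (θ v) := fun u v => rfl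
  have key := trace_comp_pos_of_adjoint Ψ
    (fun u v => by rw [hΨ, hΨ, H.map_right, H.symm])
    (fun u hu => by rw [hΨ, neg_pos]; exact H.neg _ (by simpa using hu))
    (S := -(LieAlgebra.ad ℝ I y : I →ₗ[ℝ] I)) (T := (LieAlgebra.ad ℝ I x : I →ₗ[ℝ] I))
    (fun u v => by
      rw [hΨ, hΨ]
      change -Φ ⁅(x : h), (u : h)⁆ (θ v) = -Φ (u : h) (θ (-⁅(y : h), (v : h)⁆))
      rw [hxy, map_neg, LieHom.map_lie, H.involutive, ← lie_skew, map_neg, LinearMap.neg_apply,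
        H.invariant, map_neg])
    (ad_ne_zero_of_mem_atom hI hx)
  rw [LinearMap.neg_comp, map_neg, neg_pos] at key
  rwa [killingForm_apply_apply]

lemma isCompactAlgebra_of_fixed [FiniteDimensional ℝ h] [LieAlgebra.IsSemisimple ℝ h]
    {I : LieIdeal ℝ h} (H : IsCartanPair θ Φ) (hI : IsAtom I) (hfix : ∀ x ∈ I, θ x = x) :
    IsCompactAlgebra I :=
  fun x hx => H.killingForm_map_neg hI hx (hfix x x.2).symm

lemma fixed_of_isCompactAlgebra [FiniteDimensional ℝ h] [LieAlgebra.IsSemisimple ℝ h]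
    {I : LieIdeal ℝ h} (H : IsCartanPair θ Φ) (hI : IsAtom I) (hc : IsCompactAlgebra I) :
    ∀ x ∈ I, θ x = x := by
  intro x hx
  by_contra hne
  -- Since `θ w = -w`, the Killing form of `I` would be positive at `w`.
  let w : I := ⟨x - θ x, I.sub_mem hx (H.atom_stable hI x hx)⟩
  have hw : w ≠ 0 := fun h0 => hne (sub_eq_zero.1 (congrArg Subtype.val h0)).symm
  have h1 := H.killingForm_map_neg hI (x := w) (y := -w) hw (by simp [w, H.involutive])
  have h2 := hc w hw
  rw [map_neg, LinearMap.neg_apply] at h1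
  linarith

end IsCartanPair

lemma isAtom_of_isSimple (I : LieIdeal ℝ h) (hI : LieAlgebra.IsSimple ℝ I) : IsAtom I := by
  refine ⟨?_, fun J hJ => ?_⟩
  · rintro rfl
    exact hI.non_abelian ⟨fun x y => Subsingleton.elim _ _⟩
  · rcases hI.eq_bot_or_eq_top (J.comap I.incl) with h0 | h1
    · refine (LieSubmodule.eq_bot_iff J).2 fun x hx => ?_
      have : (⟨x, hJ.le hx⟩ : I) ∈ J.comap I.incl := LieIdeal.mem_comap.2 hx
      rw [h0, LieSubmodule.mem_bot] at this
      exact congrArg Subtype.val this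
    · refine absurd (fun x hx => ?_) hJ.not_ge
      have : (⟨x, hx⟩ : I) ∈ J.comap I.incl := by rw [h1]; exact LieSubmodule.mem_top _
      exact LieIdeal.mem_comap.1 this

/-- The centralizer of an ideal, as an ideal. -/
def idealCentralizer (N : LieIdeal ℝ h) : LieIdeal ℝ h where
  carrier := {x | ∀ y ∈ N, ⁅x, y⁆ = 0}
  add_mem' hx hy z hz := by rw [add_lie, hx z hz, hy z hz, add_zero]
  zero_mem' z _ := zero_lie z
  smul_mem' c x hx z hz := by rw [smul_lie, hx z hz, smul_zero]
  lie_mem {u x} hx z hz := by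
    rw [lie_lie, hx z hz, hx _ (lie_mem_right ℝ h N u z hz), lie_zero, sub_zero]

lemma disjoint_idealCentralizer [LieAlgebra.HasTrivialRadical ℝ h] (N : LieIdeal ℝ h) :
    N ⊓ idealCentralizer N = ⊥ := by
  refine LieAlgebra.hasTrivialRadical_iff_no_abelian_ideals ℝ h |>.1 inferInstance _ ⟨?_⟩
  intro x y
  exact Subtype.ext (x.2.2 y y.2.1)

lemma atom_le_or_le_idealCentralizer {I : LieIdeal ℝ h} (hI : IsAtom I) (N : LieIdeal ℝ h) :
    I ≤ N ∨ I ≤ idealCentralizer N := by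
  rcases hI.le_iff.1 (inf_le_left : I ⊓ N ≤ I) with h0 | h1
  · right
    intro x hx y hy
    have : ⁅x, y⁆ ∈ I ⊓ N := ⟨lie_mem_left ℝ h I x y hx, lie_mem_right ℝ h N x y hy⟩
    rwa [h0, LieSubmodule.mem_bot] at this
  · left
    exact inf_eq_left.1 h1

variable (h) in
lemma noncompactPart_sup_compactPart [LieAlgebra.IsSemisimple ℝ h] :
    noncompactPart h ⊔ compactPart h = ⊤ := by
  rw [eq_top_iff, ← LieAlgebra.IsSemisimple.sSup_atoms_eq_top (R := ℝ) (L := h)]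
  refine sSup_le fun I hI => ?_
  have hs := LieAlgebra.IsSemisimple.isSimple_of_isAtom I hI
  by_cases hc : IsCompactAlgebra I
  · exact le_sup_of_le_right (le_sSup ⟨hs, hc⟩)
  · exact le_sup_of_le_left (le_sSup ⟨hs, hc⟩)

/-- If the centralizer of `N` is fixed by `θ` and no simple ideal inside `N` is fixed by `θ`, then
`N` is the noncompact part and its centralizer is the compact part. -/
lemma IsCartanPair.parts_eq [FiniteDimensional ℝ h] [LieAlgebra.IsSemisimple ℝ h]
    {θ : h →ₗ⁅ℝ⁆ h} {Φ : LinearMap.BilinForm ℝ h} (H : IsCartanPair θ Φ) (N : LieIdeal ℝ h)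
    (hN : ∀ I : LieIdeal ℝ h, IsAtom I → I ≤ N → ¬ ∀ x ∈ I, θ x = x)
    (hC : ∀ x ∈ idealCentralizer N, θ x = x) :
    noncompactPart h = N ∧ compactPart h = idealCentralizer N := by
  have h1 : noncompactPart h ≤ N := by
    refine sSup_le fun I hI => ?_
    have hat := isAtom_of_isSimple I hI.1
    refine (atom_le_or_le_idealCentralizer hat N).resolve_right fun hle => hI.2 ?_
    exact H.isCompactAlgebra_of_fixed hat fun x hx => hC x (hle hx)
  have h2 : compactPart h ≤ idealCentralizer N := by
    refine sSup_le fun I hI => ?_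
    have hat := isAtom_of_isSimple I hI.1
    refine (atom_le_or_le_idealCentralizer hat N).resolve_left fun hle => hN I hat hle ?_
    exact H.fixed_of_isCompactAlgebra hat hI.2
  -- The two parts span `h`, while `N` meets its centralizer trivially; this forces both inclusions
  -- to be equalities.
  have hdecomp : ∀ x : h, ∃ u ∈ noncompactPart h, ∃ v ∈ compactPart h, u + v = x := fun x => by
    rw [← LieSubmodule.mem_sup, noncompactPart_sup_compactPart]
    exact LieSubmodule.mem_top x
  have hdisj : ∀ x, x ∈ N → x ∈ idealCentralizer N → x = 0 := fun x hx hx' => by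
    rw [← LieSubmodule.mem_bot (R := ℝ) (L := h), ← disjoint_idealCentralizer N]
    exact ⟨hx, hx'⟩
  refine ⟨le_antisymm h1 fun x hx => ?_, le_antisymm h2 fun x hx => ?_⟩
  · obtain ⟨u, hu, v, hv, rfl⟩ := hdecomp x
    have : v = 0 := hdisj v (by simpa using N.sub_mem hx (h1 hu)) (h2 hv)
    rwa [this, add_zero]
  · obtain ⟨u, hu, v, hv, rfl⟩ := hdecomp x
    have : u = 0 :=
      hdisj u (h1 hu) (by simpa using (idealCentralizer N).sub_mem hx (h2 hv))
    rwa [this, zero_add]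

end CartanPair

/-! ### Orthogonal projections, centralizers and restricted root spaces -/

section

variable {g : Type*} [LieRing g] [LieAlgebra ℝ g]

lemma IsCartanPair.exists_add_orthogonal [FiniteDimensional ℝ g] {θ : g →ₗ⁅ℝ⁆ g}
    {Φ : LinearMap.BilinForm ℝ g} (H : IsCartanPair θ Φ) (U : Submodule ℝ g) (x : g) :
    ∃ u ∈ U, ∃ v, (∀ w ∈ U, Φ w (θ v) = 0) ∧ u + v = x := by
  let Ψ : LinearMap.BilinForm ℝ g := Φ.compl₁₂ LinearMap.id (θ : g →ₗ[ℝ] g)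
  have hΨ : ∀ u v, Ψ u v = Φ u (θ v) := fun u v => rfl
  have hrefl : Ψ.IsRefl := fun u v huv => by
    rw [hΨ] at huv ⊢
    rwa [H.map_right, H.symm]
  have hcompl : IsCompl U (Ψ.orthogonal U) := by
    rw [LinearMap.BilinForm.isCompl_orthogonal_iff_disjoint hrefl, Submodule.disjoint_def]
    exact fun y hy hy' => H.eq_zero (hy' y hy)
  obtain ⟨u, hu, v, hv, huv⟩ := Submodule.mem_sup.1
    (show x ∈ U ⊔ Ψ.orthogonal U by rw [hcompl.sup_eq_top]; exact Submodule.mem_top)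
  exact ⟨u, hu, v, fun w hw => hv w hw, huv⟩

lemma formTheta_eq_zero {θ : g ≃ₗ⁅ℝ⁆ g} {x y : g} :
    formTheta θ x y = 0 ↔ killingForm ℝ g x (θ y) = 0 := neg_eq_zero

/-- The centralizer of an element, as a Lie subalgebra. -/
def elementCentralizer (x : g) : LieSubalgebra ℝ g where
  carrier := {y | ⁅x, y⁆ = 0}
  add_mem' hy hz := by
    rw [Set.mem_ofPred_eq] at *
    rw [lie_add, hy, hz, add_zero]
  zero_mem' := lie_zero x
  smul_mem' c y hy := by
    rw [Set.mem_ofPred_eq] at *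
    rw [lie_smul, hy, smul_zero]
  lie_mem' {y z} hy hz := by
    change ⁅x, y⁆ = 0 at hy
    change ⁅x, z⁆ = 0 at hz
    change ⁅x, ⁅y, z⁆⁆ = 0
    rw [leibniz_lie, hy, hz, zero_lie, lie_zero, add_zero]

lemma mem_rootSpace_zero {a : Submodule ℝ g} {x : g} :
    x ∈ rootSpace a 0 ↔ ∀ H ∈ a, ⁅H, x⁆ = 0 := by
  constructor
  · intro hx H hH
    have h1 : ⁅H, x⁆ = (0 : Dual ℝ a) ⟨H, hH⟩ • x := hx ⟨H, hH⟩
    rwa [LinearMap.zero_apply, zero_smul] at h1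
  · intro hx H
    rw [hx H H.2, LinearMap.zero_apply, zero_smul]

lemma eq_zero_of_mem_rootSpace {a : Submodule ℝ g} {α β : Dual ℝ a} (hne : α ≠ β) {x : g}
    (hα : x ∈ rootSpace a α) (hβ : x ∈ rootSpace a β) : x = 0 := by
  obtain ⟨H, hH⟩ : ∃ H, α H ≠ β H := by
    by_contra! h0
    exact hne (LinearMap.ext h0)
  have h1 : (α H - β H) • x = 0 := by rw [sub_smul, ← hα H, ← hβ H, sub_self]
  exact (smul_eq_zero.1 h1).resolve_left (sub_ne_zero.2 hH)

end

/-! ### The subalgebras attached to `j` and their stability under `θ` -/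

namespace Data

variable {g : Type*} [LieRing g] [LieAlgebra ℝ g] (D : Data g)

lemma isCartanPair : IsCartanPair (D.θ : g →ₗ⁅ℝ⁆ g) (killingForm ℝ g) where
  involutive := D.cartan.involutive
  symm := LieModule.traceForm_comm ℝ g g
  invariant := LieModule.traceForm_apply_lie_apply ℝ g g
  map_map := LieAlgebra.killingForm_of_equiv_apply D.θ
  neg x hx := neg_pos.1 (D.cartan.pos_def x hx)

lemma theta_eq_neg_of_mem_a {x : g} (hx : x ∈ D.a) : D.θ x = -x := D.maximal_a.prop.1 hx

lemma theta_mem_rootSpace {α : Dual ℝ D.a} {x : g} (hx : x ∈ rootSpace D.a α) :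
    D.θ x ∈ rootSpace D.a (-α) := by
  intro H
  have h1 : D.θ ⁅(H : g), x⁆ = D.θ (α H • x) := congrArg D.θ (hx H)
  rw [LieEquiv.map_lie, D.theta_eq_neg_of_mem_a H.2, neg_lie, map_smul] at h1
  rw [LinearMap.neg_apply, neg_smul, ← h1, neg_neg]

/-- For `H ∈ 𝔞` the operator `ad H` is self-adjoint for `B_θ`, so its eigenspaces are orthogonal. -/
lemma killingForm_theta_eq_zero {α β : Dual ℝ D.a} (hne : α ≠ β) {x y : g}
    (hx : x ∈ rootSpace D.a α) (hy : y ∈ rootSpace D.a β) :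
    killingForm ℝ g x (D.θ y) = 0 := by
  obtain ⟨H, hH⟩ : ∃ H, α H ≠ β H := by
    by_contra! h0
    exact hne (LinearMap.ext h0)
  have h1 : killingForm ℝ g ⁅x, (H : g)⁆ (D.θ y) = killingForm ℝ g x ⁅(H : g), D.θ y⁆ :=
    D.isCartanPair.invariant _ _ _
  rw [← lie_skew, hx H, D.theta_mem_rootSpace hy H, map_neg, map_smul, LinearMap.neg_apply,
    LinearMap.smul_apply, map_smul, LinearMap.neg_apply, smul_eq_mul, smul_eq_mul] at h1
  have h2 : (α H - β H) * killingForm ℝ g x (D.θ y) = 0 := by linarith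
  exact (mul_eq_zero.1 h2).resolve_left (sub_ne_zero.2 hH)

lemma mem_a_of_commute {x : g} (hx : x ∈ pPart D.θ) (hcomm : ∀ H ∈ D.a, ⁅H, x⁆ = 0) :
    x ∈ D.a := by
  have hcomm' : ∀ H ∈ D.a, ⁅x, H⁆ = 0 := fun H hH => by
    rw [← lie_skew, hcomm H hH, neg_zero]
  have hle : D.a ⊔ Submodule.span ℝ {x} ≤ D.a := by
    refine D.maximal_a.le_of_ge ⟨?_, ?_⟩ le_sup_left
    · exact sup_le D.maximal_a.prop.1 (by simpa using hx)
    · intro y hy z hz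
      obtain ⟨y₁, hy₁, y₂, hy₂, rfl⟩ := Submodule.mem_sup.1 hy
      obtain ⟨z₁, hz₁, z₂, hz₂, rfl⟩ := Submodule.mem_sup.1 hz
      obtain ⟨c, rfl⟩ := Submodule.mem_span_singleton.1 hy₂
      obtain ⟨d, rfl⟩ := Submodule.mem_span_singleton.1 hz₂
      simp [D.maximal_a.prop.2 y₁ hy₁ z₁ hz₁, hcomm y₁ hy₁, hcomm' z₁ hz₁]
  exact hle (Submodule.mem_sup_right (Submodule.mem_span_singleton_self x))

variable (j : Fin D.r)

lemma neg_mem_rootsJ {β : Dual ℝ D.a} (hβ : β ∈ D.rootsJ j) : -β ∈ D.rootsJ j := by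
  refine ⟨⟨neg_ne_zero.2 hβ.1.1, fun h0 => ?_⟩, Submodule.neg_mem _ hβ.2⟩
  obtain ⟨x, hx, hx0⟩ := Submodule.exists_mem_ne_zero_of_ne_bot hβ.1.2
  have h1 := D.theta_mem_rootSpace hx
  rw [h0, Submodule.mem_bot] at h1
  exact hx0 (by rw [← D.cartan.involutive x, h1, map_zero])

lemma apply_eq_zero_of_mem_aJ {β : Dual ℝ D.a} (hβ : β ∈ Submodule.span ℝ (D.Phi j)) {u : g}
    (hu : u ∈ D.aJ j) (hua : u ∈ D.a) : β ⟨u, hua⟩ = 0 := by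
  have h1 : Submodule.span ℝ (D.Phi j) ≤ LinearMap.ker (Dual.eval ℝ D.a (⟨u, hua⟩ : D.a)) :=
    Submodule.span_le.2 fun γ hγ => hu.2 γ hγ
  exact h1 hβ

lemma mem_mJ {x : g} :
    x ∈ D.mJ j ↔ x ∈ D.lJ j ∧ ∀ u ∈ D.aJ j, killingForm ℝ g x (D.θ u) = 0 := by
  change (_ ∧ ∀ u ∈ D.aJ j, formTheta D.θ x u = 0) ↔ _
  simp only [formTheta_eq_zero]

lemma theta_mem_lJ {x : g} (hx : x ∈ D.lJ j) : D.θ x ∈ D.lJ j := by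
  have h1 : D.lJ j ≤ (D.lJ j).comap ((D.θ : g →ₗ⁅ℝ⁆ g) : g →ₗ[ℝ] g) :=
    D.lJ_le j fun β hβ y hy =>
      D.rootSpace_le_lJ j (Submodule.neg_mem _ hβ) (D.theta_mem_rootSpace hy)
  exact h1 hx

lemma theta_mem_mJ {x : g} (hx : x ∈ D.mJ j) : D.θ x ∈ D.mJ j := by
  rw [mem_mJ] at hx ⊢
  refine ⟨D.theta_mem_lJ j hx.1, fun u hu => ?_⟩
  have h1 : killingForm ℝ g (D.θ x) (D.θ (-D.θ u)) = killingForm ℝ g x (-D.θ u) :=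
    D.isCartanPair.map_map _ _
  rw [D.theta_eq_neg_of_mem_a hu.1, neg_neg, D.theta_eq_neg_of_mem_a hu.1] at *
  have h2 := hx.2 u hu
  rw [D.theta_eq_neg_of_mem_a hu.1, map_neg, neg_eq_zero] at h2
  rw [map_neg] at h1 ⊢
  rw [h1, h2]

lemma gJ_le_mJ {x : g} (hx : x ∈ D.gJ j) : x ∈ D.mJ j := by
  have hle : (D.gJ j).toSubmodule ≤ (D.mJ j).toSubmodule := by
    refine Submodule.span_le.2 ?_
    rintro _ ⟨x, hx, y, hy, rfl⟩
    exact (D.mJ j).lie_mem hx hy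
  exact hle hx

lemma lie_mem_gJ {x y : g} (hx : x ∈ D.mJ j) (hy : y ∈ D.mJ j) : ⁅x, y⁆ ∈ D.gJ j :=
  Submodule.subset_span ⟨x, hx, y, hy, rfl⟩

lemma theta_mem_gJ {x : g} (hx : x ∈ D.gJ j) : D.θ x ∈ D.gJ j := by
  have hle : (D.gJ j).toSubmodule ≤
      (D.gJ j).toSubmodule.comap ((D.θ : g →ₗ⁅ℝ⁆ g) : g →ₗ[ℝ] g) := by
    refine Submodule.span_le.2 ?_
    rintro _ ⟨x, hx, y, hy, rfl⟩
    change D.θ ⁅x, y⁆ ∈ D.gJ j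
    rw [LieEquiv.map_lie]
    exact D.lie_mem_gJ j (D.theta_mem_mJ j hx) (D.theta_mem_mJ j hy)
  exact hle hx

lemma mem_zJ {x : g} : x ∈ D.zJ j ↔ x ∈ D.mJ j ∧ ∀ y ∈ D.mJ j, ⁅x, y⁆ = 0 := Iff.rfl

lemma killingForm_theta_gJ_zJ {x y : g} (hx : x ∈ D.gJ j) (hy : y ∈ D.zJ j) :
    killingForm ℝ g x (D.θ y) = 0 := by
  have hle : (D.gJ j).toSubmodule ≤ LinearMap.ker ((killingForm ℝ g).flip (D.θ y)) := by
    refine Submodule.span_le.2 ?_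
    rintro _ ⟨u, hu, v, hv, rfl⟩
    change killingForm ℝ g ⁅u, v⁆ (D.θ y) = 0
    have h1 : ⁅D.θ v, y⁆ = 0 := by rw [← lie_skew, hy.2 _ (D.theta_mem_mJ j hv), neg_zero]
    have h2 : ⁅v, D.θ y⁆ = 0 := by
      rw [← D.cartan.involutive v, ← LieEquiv.map_lie, h1, map_zero]
    rw [D.isCartanPair.invariant, h2, map_zero]
  exact hle hx

lemma rootSpace_le_mJ {β : Dual ℝ D.a} (hβ : β ∈ D.rootsJ j) {x : g}
    (hx : x ∈ rootSpace D.a β) : x ∈ D.mJ j := by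
  refine (D.mem_mJ j).2 ⟨D.rootSpace_le_lJ j hβ.2 hx, fun u hu => ?_⟩
  refine D.killingForm_theta_eq_zero hβ.1.1 hx (mem_rootSpace_zero.2 fun H hH => ?_)
  exact D.maximal_a.prop.2 H hH u hu.1

lemma a_le_lJ {H : g} (hH : H ∈ D.a) : H ∈ D.lJ j :=
  D.rootSpace_le_lJ j (Submodule.zero_mem _)
    (mem_rootSpace_zero.2 fun H' hH' => D.maximal_a.prop.2 H' hH' H hH)

lemma lie_eq_zero_of_mem_gTilde {x y : g}
    (hx : ∀ β ∈ D.rootsJ j, ∀ z ∈ rootSpace D.a β, ⁅x, z⁆ = 0) (hy : y ∈ D.gTilde j) :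
    ⁅x, y⁆ = 0 := by
  have hle : D.gTilde j ≤ elementCentralizer x :=
    LieSubalgebra.lieSpan_le.2 (Set.iUnion₂_subset fun β hβ z hz => hx β hβ z hz)
  exact hle hy

lemma rootSpace_le_gTilde {β : Dual ℝ D.a} (hβ : β ∈ D.rootsJ j) {x : g}
    (hx : x ∈ rootSpace D.a β) : x ∈ D.gTilde j :=
  LieSubalgebra.subset_lieSpan (Set.mem_iUnion₂.2 ⟨β, hβ, hx⟩)

lemma theta_mem_gTilde {x : g} (hx : x ∈ D.gTilde j) : D.θ x ∈ D.gTilde j := by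
  have hle : D.gTilde j ≤ (D.gTilde j).comap (D.θ : g →ₗ⁅ℝ⁆ g) :=
    LieSubalgebra.lieSpan_le.2 (Set.iUnion₂_subset fun β hβ z hz =>
      D.rootSpace_le_gTilde j (D.neg_mem_rootsJ j hβ) (D.theta_mem_rootSpace hz))
  exact hle hx

/-- The space `𝔤_0` preserves each generating root space, and the other summands of `𝔩_j` lie in the
subalgebra itself. -/
lemma lie_mem_gTilde {x y : g} (hx : x ∈ D.lJ j) (hy : y ∈ D.gTilde j) :
    ⁅x, y⁆ ∈ D.gTilde j := by
  have hle : D.lJ j ≤ (D.gTilde j).normalizer.toSubmodule := by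
    refine sup_le (fun u hu => ?_) (iSup₂_le fun β hβ u hu => ?_)
    · change u ∈ (D.gTilde j).normalizer
      rw [LieSubalgebra.mem_normalizer_iff]
      intro y hy
      induction hy using LieSubalgebra.lieSpan_induction with
      | mem z hz =>
        obtain ⟨β, hβ, hz⟩ := Set.mem_iUnion₂.1 hz
        refine D.rootSpace_le_gTilde j hβ ?_
        simpa using lie_mem_rootSpace hu hz
      | zero => rw [lie_zero]; exact zero_mem _
      | add z w _ _ hz hw => rw [lie_add]; exact add_mem hz hw
      | smul c z _ hz => rw [lie_smul]; exact (D.gTilde j).smul_mem c hz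
      | lie z w hz' hw' hz hw =>
        rw [leibniz_lie]
        exact add_mem ((D.gTilde j).lie_mem hz hw') ((D.gTilde j).lie_mem hz' hw)
    · exact LieSubalgebra.le_normalizer _ (D.rootSpace_le_gTilde j hβ hu)
  exact (LieSubalgebra.mem_normalizer_iff _ _).1 (hle hx) y hy

/-- The element `x - θ x` lies in `𝔭` and centralizes `𝔞`, so it is in `𝔞`. Commuting with the root
spaces of `Φ_j` puts it in `𝔞_j`, to which `𝔪_j` is orthogonal. -/
lemma theta_eq_self_of_commute {x : g} (hx : x ∈ D.mJ j) (h0 : x ∈ rootSpace D.a 0)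
    (hcomm : ∀ β ∈ D.rootsJ j, ∀ z ∈ rootSpace D.a β, ⁅x, z⁆ = 0) : D.θ x = x := by
  have hcomm' : ∀ β ∈ D.rootsJ j, ∀ z ∈ rootSpace D.a β, ⁅D.θ x, z⁆ = 0 := fun β hβ z hz => by
    rw [← D.cartan.involutive z, ← LieEquiv.map_lie,
      hcomm _ (D.neg_mem_rootsJ j hβ) _ (D.theta_mem_rootSpace hz), map_zero]
  have h0' : D.θ x ∈ rootSpace D.a 0 := by simpa using D.theta_mem_rootSpace h0
  have hya : x - D.θ x ∈ D.a := by
    refine D.mem_a_of_commute ?_ (mem_rootSpace_zero.1 (Submodule.sub_mem _ h0 h0'))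
    change D.θ (x - D.θ x) = -(x - D.θ x)
    rw [map_sub, D.cartan.involutive, neg_sub]
  have hyJ : x - D.θ x ∈ D.aJ j := by
    refine ⟨hya, ?_⟩
    rintro _ ⟨i, hi, rfl⟩
    have hroot : D.simple i ∈ D.rootsJ j :=
      ⟨D.isSimpleSystem.1 i, Submodule.subset_span ⟨i, hi, rfl⟩⟩
    obtain ⟨z, hz, hz0⟩ := Submodule.exists_mem_ne_zero_of_ne_bot hroot.1.2
    have h1 : ⁅x - D.θ x, z⁆ = D.simple i ⟨x - D.θ x, hya⟩ • z := hz ⟨x - D.θ x, hya⟩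
    rw [sub_lie, hcomm _ hroot z hz, hcomm' _ hroot z hz, sub_zero, eq_comm] at h1
    exact (smul_eq_zero.1 h1).resolve_right hz0
  have hym : x - D.θ x ∈ D.mJ j := sub_mem hx (D.theta_mem_mJ j hx)
  have h1 : x - D.θ x = 0 := D.isCartanPair.eq_zero (((D.mem_mJ j).1 hym).2 _ hyJ)
  exact (sub_eq_zero.1 h1).symm

lemma mem_k0_of_commute {x : g} (hx : x ∈ D.mJ j) (h0 : x ∈ rootSpace D.a 0)
    (hcomm : ∀ β ∈ D.rootsJ j, ∀ z ∈ rootSpace D.a β, ⁅x, z⁆ = 0) : x ∈ D.k0 := by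
  refine ⟨D.theta_eq_self_of_commute j hx h0 hcomm, fun H hH => ?_⟩
  rw [← lie_skew, mem_rootSpace_zero.1 h0 H hH, neg_zero]

/-- The restriction of `θ` to `𝔤_j`. -/
def thetaJ : D.gJ j →ₗ⁅ℝ⁆ D.gJ j where
  toFun x := ⟨D.θ x, D.theta_mem_gJ j x.2⟩
  map_add' x y := Subtype.ext (map_add D.θ (x : g) y)
  map_smul' c x := Subtype.ext (map_smul D.θ c (x : g))
  map_lie' {x y} := Subtype.ext (LieEquiv.map_lie D.θ (x : g) y)

/-! ### The splittings of `𝔞` along `𝔞_j` and of `𝔪_j` along `𝔷_j` -/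

section FiniteDimensional

variable [FiniteDimensional ℝ g]

/-- Since `𝔞_j` commutes with `𝔩_j`, this lets `𝔞 ∩ 𝔪_j`, which lies in `𝔤_j`, play the role of `𝔞`.
-/
lemma exists_aJ_add_mJ {H : g} (hH : H ∈ D.a) :
    ∃ u ∈ D.aJ j, ∃ v ∈ D.a, v ∈ D.mJ j ∧ u + v = H := by
  obtain ⟨u, hu, v, hv, rfl⟩ := D.isCartanPair.exists_add_orthogonal (D.aJ j) H
  have hva : v ∈ D.a := (Submodule.add_mem_iff_right _ hu.1).1 hH
  refine ⟨u, hu, v, hva, (D.mem_mJ j).2 ⟨D.a_le_lJ j hva, fun w hw => ?_⟩, rfl⟩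
  have h1 : killingForm ℝ g w (D.θ v) = 0 := hv w hw
  have h2 : killingForm ℝ g w (D.θ v) = killingForm ℝ g (D.θ w) v := D.isCartanPair.map_right w v
  rw [D.isCartanPair.symm, ← h2, h1]

/-- Commuting with `𝔞 ∩ 𝔪_j` is enough for an element of `𝔩_j` to lie in `𝔤_0`. -/
lemma mem_rootSpace_zero_of_commute {x : g} (hx : x ∈ D.lJ j)
    (hcomm : ∀ v ∈ D.a, v ∈ D.mJ j → ⁅v, x⁆ = 0) : x ∈ rootSpace D.a 0 := by
  refine mem_rootSpace_zero.2 fun H hH => ?_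
  obtain ⟨u, hu, v, hva, hvm, rfl⟩ := D.exists_aJ_add_mJ j hH
  rw [add_lie, D.lie_aJ_lJ j hx hu, hcomm v hva hvm, add_zero]

lemma exists_mem_a_mJ_apply_ne_zero {β : Dual ℝ D.a} (hβ : β ∈ D.rootsJ j) :
    ∃ v : D.a, (v : g) ∈ D.mJ j ∧ β v ≠ 0 := by
  obtain ⟨H, hH⟩ : ∃ H, β H ≠ 0 := by
    by_contra! h0
    exact hβ.1.1 (LinearMap.ext h0)
  obtain ⟨u, hu, v, hva, hvm, huv⟩ := D.exists_aJ_add_mJ j H.2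
  refine ⟨⟨v, hva⟩, hvm, fun h0 => hH ?_⟩
  have h1 : H = ⟨u, hu.1⟩ + ⟨v, hva⟩ := Subtype.ext huv.symm
  rw [h1, map_add, h0, D.apply_eq_zero_of_mem_aJ j hβ.2 hu, add_zero]

lemma rootSpace_le_gJ {β : Dual ℝ D.a} (hβ : β ∈ D.rootsJ j) {x : g}
    (hx : x ∈ rootSpace D.a β) : x ∈ D.gJ j := by
  obtain ⟨v, hvm, hv⟩ := D.exists_mem_a_mJ_apply_ne_zero j hβ
  have h1 : x = (β v)⁻¹ • ⁅(v : g), x⁆ := by rw [hx v, inv_smul_smul₀ hv]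
  rw [h1]
  exact (D.gJ j).smul_mem _ (D.lie_mem_gJ j hvm (D.rootSpace_le_mJ j hβ hx))

lemma gTilde_le_gJ {x : g} (hx : x ∈ D.gTilde j) : x ∈ D.gJ j := by
  have hle : D.gTilde j ≤ D.gJ j := by
    refine LieSubalgebra.lieSpan_le.2 (Set.iUnion₂_subset fun β hβ x hx => ?_)
    exact D.rootSpace_le_gJ j hβ hx
  exact hle hx

lemma zJ_le_k0 : D.zJ j ≤ D.k0 := by
  intro x hx
  refine D.mem_k0_of_commute j hx.1 ?_ fun β hβ z hz => hx.2 z (D.rootSpace_le_mJ j hβ hz)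
  refine D.mem_rootSpace_zero_of_commute j ((D.mem_mJ j).1 hx.1).1 fun v _ hvm => ?_
  rw [← lie_skew, hx.2 v hvm, neg_zero]

/-- The component of `x` orthogonal to `𝔤_j` is central in `𝔪_j`, hence orthogonal to `x` and so to
itself. -/
lemma mem_gJ_of_orthogonal {x : g} (hx : x ∈ D.mJ j)
    (h0 : ∀ z ∈ D.zJ j, killingForm ℝ g x (D.θ z) = 0) : x ∈ D.gJ j := by
  obtain ⟨u, hu, v, hv, rfl⟩ := D.isCartanPair.exists_add_orthogonal (D.gJ j).toSubmodule x
  have hvm : v ∈ D.mJ j := by simpa using sub_mem hx (D.gJ_le_mJ j hu)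
  have hvz : v ∈ D.zJ j := by
    refine (D.mem_zJ j).2 ⟨hvm, fun w hw => D.isCartanPair.eq_zero ?_⟩
    -- By invariance, pairing `v` with this element gives the squared length of `⁅v, w⁆` up to sign.
    have hmem : ⁅w, D.θ ⁅v, w⁆⁆ ∈ D.gJ j :=
      D.lie_mem_gJ j hw (D.theta_mem_mJ j ((D.mJ j).lie_mem hvm hw))
    have h1 := hv _ (D.theta_mem_gJ j hmem)
    have h2 := D.isCartanPair.map_map ⁅w, D.θ ⁅v, w⁆⁆ v
    rw [D.isCartanPair.invariant, D.isCartanPair.symm]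
    exact h2.symm.trans h1
  have h1 := h0 v hvz
  rw [map_add, LinearMap.add_apply, show killingForm ℝ g u (D.θ v) = 0 from hv u hu, zero_add] at h1
  rw [D.isCartanPair.eq_zero h1, add_zero]
  exact hu

/-- Here `𝔷_j ⊆ 𝔨` and `𝔞 ⊆ 𝔭`, so `v` is orthogonal to `𝔷_j`. -/
lemma mem_gJ_of_mem_a {v : g} (hva : v ∈ D.a) (hvm : v ∈ D.mJ j) : v ∈ D.gJ j := by
  refine D.mem_gJ_of_orthogonal j hvm fun z hz => ?_
  have h1 : D.θ z = z := (D.zJ_le_k0 j hz).1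
  have h2 := D.isCartanPair.map_map v z
  change killingForm ℝ g (D.θ v) (D.θ z) = _ at h2
  rw [D.theta_eq_neg_of_mem_a hva, h1, map_neg, LinearMap.neg_apply] at h2
  rw [h1]
  linarith

end FiniteDimensional

end Data
lemma eq_zero_of_eq_neg {V : Type*} [AddCommGroup V] [Module ℝ V] {v : V} (hv : v = -v) :
    v = 0 := by
  have h2 : (2 : ℝ) • v = 0 := by rw [two_smul, add_eq_zero_iff_eq_neg, ← hv]
  exact (smul_eq_zero.1 h2).resolve_left two_ne_zero

/-! ### Semisimplicity of `𝔤_j` and identification of its two parts -/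

namespace Data

variable {g : Type*} [LieRing g] [LieAlgebra ℝ g] (D : Data g) (j : Fin D.r)

lemma isCartanPair_gJ :
    IsCartanPair (D.thetaJ j) ((killingForm ℝ g).restrict (D.gJ j).toSubmodule) :=
  D.isCartanPair.restrict (D.gJ j) (D.thetaJ j) fun _ => rfl

/-- A central element of `𝔤_j` is already central in `𝔪_j`, and `𝔷_j` is orthogonal to `𝔤_j`. -/
lemma isSemisimple_gJ [FiniteDimensional ℝ g] : LieAlgebra.IsSemisimple ℝ (D.gJ j) := by
  refine (D.isCartanPair_gJ j).isSemisimple fun x hx => Subtype.ext ?_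
  refine D.isCartanPair.eq_zero (D.killingForm_theta_gJ_zJ j x.2 ?_)
  refine (D.mem_zJ j).2 ⟨D.gJ_le_mJ j x.2, fun w hw => D.isCartanPair.lie_eq_zero ?_⟩
  have hmem : D.θ ⁅(x : g), w⁆ ∈ D.gJ j :=
    D.theta_mem_gJ j (D.lie_mem_gJ j (D.gJ_le_mJ j x.2) hw)
  exact congrArg Subtype.val (hx ⟨_, hmem⟩)

/-- An element of `𝔩_j` orthogonal to the root spaces of `Σ_j` lies in `𝔤_0`. -/
lemma mem_rootSpace_zero_of_orthogonal {x : g} (hx : x ∈ D.lJ j)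
    (horth : ∀ β ∈ D.rootsJ j, ∀ z ∈ rootSpace D.a β, killingForm ℝ g x z = 0) :
    x ∈ rootSpace D.a 0 := by
  obtain ⟨u, hu, v, hv, rfl⟩ := Submodule.mem_sup.1 hx
  have h1 : (⨆ β ∈ D.rootsJ j, rootSpace D.a β) ≤
      ((LinearMap.ker (killingForm ℝ g v)).comap ((D.θ : g →ₗ⁅ℝ⁆ g) : g →ₗ[ℝ] g)) := by
    refine iSup₂_le fun β hβ z hz => ?_
    change killingForm ℝ g v (D.θ z) = 0
    have h2 := horth _ (D.neg_mem_rootsJ j hβ) _ (D.theta_mem_rootSpace hz)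
    rwa [map_add, LinearMap.add_apply, D.killingForm_theta_eq_zero hβ.1.1.symm hu hz,
      zero_add] at h2
  have h2 : v = 0 := D.isCartanPair.eq_zero (h1 hv)
  rwa [h2, add_zero]

lemma k0_le_mJ {x : g} (hx : x ∈ D.k0) : x ∈ D.mJ j := by
  have h0 : x ∈ rootSpace D.a 0 := mem_rootSpace_zero.2 fun H hH => by
    rw [← lie_skew, hx.2 H hH, neg_zero]
  refine (D.mem_mJ j).2 ⟨D.rootSpace_le_lJ j (Submodule.zero_mem _) h0, fun u hu => ?_⟩
  have h1 := D.isCartanPair.map_map x u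
  change killingForm ℝ g (D.θ x) (D.θ u) = _ at h1
  rw [show D.θ x = x from hx.1, D.theta_eq_neg_of_mem_a hu.1, map_neg] at h1
  rw [D.theta_eq_neg_of_mem_a hu.1, map_neg]
  linarith

variable [FiniteDimensional ℝ g]

/-- The subalgebra generated by the root spaces of `Σ_j`, as an ideal of `𝔤_j`. -/
def gTildeIdeal : LieIdeal ℝ (D.gJ j) where
  __ := (D.gTilde j).toSubmodule.comap (D.gJ j).toSubmodule.subtype
  lie_mem {x _} hy := D.lie_mem_gTilde j ((D.mem_mJ j).1 (D.gJ_le_mJ j x.2)).1 hy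

lemma map_gTildeIdeal :
    (D.gTildeIdeal j).toSubmodule.map (D.gJ j).toSubmodule.subtype = (D.gTilde j).toSubmodule := by
  ext x
  constructor
  · rintro ⟨y, hy, rfl⟩
    exact hy
  · intro hx
    exact ⟨⟨x, D.gTilde_le_gJ j hx⟩, hx, rfl⟩

lemma mem_idealCentralizer_gTildeIdeal {x : D.gJ j} :
    x ∈ idealCentralizer (D.gTildeIdeal j) ↔
      ∀ β ∈ D.rootsJ j, ∀ z ∈ rootSpace D.a β, ⁅(x : g), z⁆ = 0 := by
  constructor
  · intro hx β hβ z hz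
    exact congrArg Subtype.val (hx ⟨z, D.rootSpace_le_gJ j hβ hz⟩ (D.rootSpace_le_gTilde j hβ hz))
  · intro hx y hy
    exact Subtype.ext (D.lie_eq_zero_of_mem_gTilde j hx hy)

/-- Elements of `𝔤_j` commuting with the root spaces of `Σ_j` are orthogonal to them. -/
lemma killingForm_rootSpace_eq_zero {x : g}
    (hcomm : ∀ β ∈ D.rootsJ j, ∀ z ∈ rootSpace D.a β, ⁅x, z⁆ = 0) {β : Dual ℝ D.a}
    (hβ : β ∈ D.rootsJ j) {z : g} (hz : z ∈ rootSpace D.a β) : killingForm ℝ g x z = 0 := by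
  obtain ⟨v, -, hv⟩ := D.exists_mem_a_mJ_apply_ne_zero j hβ
  have h1 : β v • killingForm ℝ g x z = 0 := by
    -- Up to a nonzero scalar `z` is the bracket `⁅v, z⁆`, and invariance moves `z` next to `x`.
    rw [← map_smul, ← hz v, ← lie_skew, map_neg, ← D.isCartanPair.invariant, hcomm β hβ z hz,
      map_zero, LinearMap.zero_apply, neg_zero]
  exact (smul_eq_zero.1 h1).resolve_left hv

lemma killingForm_gTilde_eq_zero {x y : g}
    (hcomm : ∀ β ∈ D.rootsJ j, ∀ z ∈ rootSpace D.a β, ⁅x, z⁆ = 0) (hy : y ∈ D.gTilde j) :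
    killingForm ℝ g x y = 0 := by
  induction hy using LieSubalgebra.lieSpan_induction with
  | mem z hz =>
    obtain ⟨β, hβ, hz⟩ := Set.mem_iUnion₂.1 hz
    exact D.killingForm_rootSpace_eq_zero j hcomm hβ hz
  | zero => exact map_zero _
  | add z w _ _ hz hw => rw [map_add, hz, hw, add_zero]
  | smul c z _ hz => rw [map_smul, hz, smul_zero]
  | lie z w hz _ _ _ =>
    rw [← D.isCartanPair.invariant, D.lie_eq_zero_of_mem_gTilde j hcomm hz, map_zero,
      LinearMap.zero_apply]

lemma mem_k0_of_mem_gJ {x : g} (hx : x ∈ D.gJ j)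
    (hcomm : ∀ β ∈ D.rootsJ j, ∀ z ∈ rootSpace D.a β, ⁅x, z⁆ = 0) : x ∈ D.k0 := by
  have hxm := D.gJ_le_mJ j hx
  refine D.mem_k0_of_commute j hxm ?_ hcomm
  exact D.mem_rootSpace_zero_of_orthogonal j ((D.mem_mJ j).1 hxm).1 fun β hβ z hz =>
    D.killingForm_rootSpace_eq_zero j hcomm hβ hz

lemma not_fixed_of_le_gTildeIdeal {I : LieIdeal ℝ (D.gJ j)} (hI : IsAtom I)
    (hle : I ≤ D.gTildeIdeal j) : ¬ ∀ x ∈ I, D.thetaJ j x = x := by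
  intro hfix
  have := D.isSemisimple_gJ j
  have h0 : ∀ x ∈ I, (x : g) ∈ rootSpace D.a 0 := by
    intro x hx
    refine D.mem_rootSpace_zero_of_commute j ((D.mem_mJ j).1 (D.gJ_le_mJ j x.2)).1
      fun v hva hvm => ?_
    -- The bracket lies in `I`, hence in `𝔨`, but also in `[𝔭, 𝔨] ⊆ 𝔭`.
    have h1 : D.θ ⁅v, (x : g)⁆ = ⁅v, (x : g)⁆ := congrArg Subtype.val
      (hfix _ (lie_mem_right ℝ (D.gJ j) I ⟨v, D.mem_gJ_of_mem_a j hva hvm⟩ x hx))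
    have h2 : D.θ (x : g) = x := congrArg Subtype.val (hfix x hx)
    rw [LieEquiv.map_lie, D.theta_eq_neg_of_mem_a hva, h2, neg_lie] at h1
    exact eq_zero_of_eq_neg h1.symm
  refine hI.1 ((LieSubmodule.eq_bot_iff I).2 fun x hx => ?_)
  refine IsCartanPair.eq_zero_of_mem_atom hI hx fun y hy => ?_
  refine (D.mem_idealCentralizer_gTildeIdeal j).2 (fun β hβ z hz => ?_) y (hle hy)
  -- The bracket `⁅x, z⁆` lies in `I ⊆ 𝔤_0` and in `𝔤_β`, so it vanishes.
  have h1 := h0 _ (lie_mem_left ℝ (D.gJ j) I x ⟨z, D.rootSpace_le_gJ j hβ hz⟩ hx)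
  have h2 : ⁅(x : g), z⁆ ∈ rootSpace D.a β := by simpa using lie_mem_rootSpace (h0 x hx) hz
  exact eq_zero_of_mem_rootSpace hβ.1.1 h2 h1

lemma parts_gJ : noncompactPart (D.gJ j) = D.gTildeIdeal j ∧
    compactPart (D.gJ j) = idealCentralizer (D.gTildeIdeal j) := by
  have := D.isSemisimple_gJ j
  refine (D.isCartanPair_gJ j).parts_eq _ (fun I hI hle => D.not_fixed_of_le_gTildeIdeal j hI hle)
    fun x hx => Subtype.ext ?_
  exact (D.mem_k0_of_mem_gJ j x.2 ((D.mem_idealCentralizer_gTildeIdeal j).1 hx)).1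

lemma noncompactPartJ_eq : D.noncompactPartJ j = (D.gTilde j).toSubmodule := by
  rw [noncompactPartJ, (D.parts_gJ j).1, map_gTildeIdeal]

lemma mem_compactPartJ {x : g} : x ∈ D.compactPartJ j ↔
    x ∈ D.gJ j ∧ ∀ β ∈ D.rootsJ j, ∀ z ∈ rootSpace D.a β, ⁅x, z⁆ = 0 := by
  rw [compactPartJ, (D.parts_gJ j).2]
  constructor
  · rintro ⟨y, hy, rfl⟩
    exact ⟨y.2, (D.mem_idealCentralizer_gTildeIdeal j).1 hy⟩
  · rintro ⟨hx, hcomm⟩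
    exact ⟨⟨x, hx⟩, (D.mem_idealCentralizer_gTildeIdeal j).2 hcomm, rfl⟩

lemma zJ_le_centralizerIn : D.zJ j ≤ centralizerIn D.k0 (D.bJ j) :=
  fun _ hx => ⟨D.zJ_le_k0 j hx, fun s hs => hx.2 s (D.gJ_le_mJ j hs.1)⟩

/-- Commuting with `z - θ z ∈ 𝔟_j` gives `⁅x, z⁆ = ⁅x, θ z⁆`, an element of `𝔤_β ∩ 𝔤_{-β} = 0`. -/
lemma lie_rootSpace_eq_zero_of_mem_centralizerIn {x : g}
    (hx : x ∈ centralizerIn D.k0 (D.bJ j)) {β : Dual ℝ D.a} (hβ : β ∈ D.rootsJ j) {z : g}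
    (hz : z ∈ rootSpace D.a β) : ⁅x, z⁆ = 0 := by
  have h0 : x ∈ rootSpace D.a 0 := mem_rootSpace_zero.2 fun H hH => by
    rw [← lie_skew, hx.1.2 H hH, neg_zero]
  have hzg := D.rootSpace_le_gJ j hβ hz
  have hb : z - D.θ z ∈ D.bJ j := by
    refine ⟨sub_mem hzg (D.theta_mem_gJ j hzg), ?_⟩
    change D.θ (z - D.θ z) = -(z - D.θ z)
    rw [map_sub, D.cartan.involutive, neg_sub]
  have h1 := hx.2 _ hb
  rw [lie_sub, sub_eq_zero] at h1
  have h2 : ⁅x, z⁆ ∈ rootSpace D.a β := by simpa using lie_mem_rootSpace h0 hz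
  have h3 : ⁅x, z⁆ ∈ rootSpace D.a (-β) := by
    rw [h1]
    simpa using lie_mem_rootSpace h0 (D.theta_mem_rootSpace hz)
  exact eq_zero_of_mem_rootSpace (fun h => hβ.1.1 (eq_zero_of_eq_neg h)) h2 h3

lemma compactPartJ_eq :
    D.compactPartJ j = orthIn D.θ (centralizerIn D.k0 (D.bJ j)) (D.zJ j) := by
  ext x
  rw [mem_compactPartJ]
  constructor
  · rintro ⟨hx, hcomm⟩
    refine ⟨⟨D.mem_k0_of_mem_gJ j hx hcomm, fun s hs => ?_⟩,
      fun u hu => formTheta_eq_zero.2 (D.killingForm_theta_gJ_zJ j hx hu)⟩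
    have hxfix : D.θ x = x := (D.mem_k0_of_mem_gJ j hx hcomm).1
    have hsneg : D.θ s = -s := hs.2
    -- The centralizer is an ideal fixed by `θ`, so it contains `⁅x, s⁆`, which then lies in both
    -- `𝔨` and `𝔭`.
    have hcomm' : ∀ β ∈ D.rootsJ j, ∀ z ∈ rootSpace D.a β, ⁅⁅x, s⁆, z⁆ = 0 := by
      have hmem := (D.mem_idealCentralizer_gTildeIdeal j (x := ⟨x, hx⟩)).2 hcomm
      have hlie := lie_mem_left ℝ (D.gJ j) _ _ ⟨s, hs.1⟩ hmem
      exact (D.mem_idealCentralizer_gTildeIdeal j).1 hlie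
    have h1 : D.θ ⁅x, s⁆ = ⁅x, s⁆ :=
      (D.mem_k0_of_mem_gJ j ((D.gJ j).lie_mem hx hs.1) hcomm').1
    rw [LieEquiv.map_lie, hxfix, hsneg, lie_neg] at h1
    exact eq_zero_of_eq_neg h1.symm
  · rintro ⟨hx, horth⟩
    exact ⟨D.mem_gJ_of_orthogonal j (D.k0_le_mJ j hx.1)
        fun z hz => formTheta_eq_zero.1 (horth z hz),
      fun β hβ z hz => D.lie_rootSpace_eq_zero_of_mem_centralizerIn j hx hβ hz⟩

lemma formTheta_compactPartJ_noncompactPartJ {x y : g} (hx : x ∈ D.compactPartJ j)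
    (hy : y ∈ D.noncompactPartJ j) : formTheta D.θ x y = 0 := by
  rw [noncompactPartJ_eq] at hy
  exact formTheta_eq_zero.2 (D.killingForm_gTilde_eq_zero j ((D.mem_compactPartJ j).1 hx).2
    (D.theta_mem_gTilde j hy))

end Data

end NoncompactPart

theorem mainTheorem5 {g : Type*} [LieRing g] [LieAlgebra ℝ g] [FiniteDimensional ℝ g]
    [LieAlgebra.IsSemisimple ℝ g] (D : NoncompactPart.Data g) (j : Fin D.r) :
    LieAlgebra.IsSemisimple ℝ (D.gJ j) ∧
    D.noncompactPartJ j = (D.gTilde j).toSubmodule ∧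
    D.zJ j ≤ NoncompactPart.centralizerIn D.k0 (D.bJ j) ∧
    D.compactPartJ j =
      NoncompactPart.orthIn D.θ (NoncompactPart.centralizerIn D.k0 (D.bJ j)) (D.zJ j) ∧
    ∀ x ∈ D.compactPartJ j, ∀ y ∈ D.noncompactPartJ j,
      NoncompactPart.formTheta D.θ x y = 0 :=
  ⟨D.isSemisimple_gJ j, D.noncompactPartJ_eq j, D.zJ_le_centralizerIn j, D.compactPartJ_eq j,
    fun _ hx _ hy => D.formTheta_compactPartJ_noncompactPartJ j hx hy⟩
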